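/- Let $0<\nu<1$. For $\mu\in\mathbb{R}$, $c>0$ and $t>0$ let $$f_{\nu,\mu}(t)=\mathcal{L}^{-1}\{s^{-\mu}e^{-s^\nu}\}(t)=\frac{1}{2\pi i}\int_{c-i\infty}^{c+i\infty}e^{st}\,s^{-\mu}e^{-s^{\nu}}\,ds$$ (principal branch of the powers), and for $\lambda>-1$ and $\mu,z\in\mathbb{C}$ let $$W_{\lambda,\mu}(z)=\sum_{k=0}^{\infty}\frac{z^k}{k!\,\Gamma(\lambda k+\mu)}$$ be the Wright function (with $1/\Gamma=0$ at the poles of $\Gamma$). Let $F_\nu(z)=W_{-\nu,0}(-z)$ and $M_\nu(z)=W_{-\nu,1-\nu}(-z)$ be the Mainardi functions. Then for all $t>0$ and $c>0$ the following hold. (a) For every real $\mu$ the integral defining $f_{\nu,\mu}(t)$ converges absolutely. (b) For every real $\mu<1$, $$f_{\nu,\mu}(t)=\frac1\pi\int_0^\infty u^{-\mu}\,e^{-ut-u^\nu\cos(\pi\nu)}\,\sin\bigl(u^\nu\sin(\pi\nu)+\pi\mu\bigr)\,du ,$$ where the integral converges absolutely. (c) For every real $\mu$ the series for $W_{-\nu,\mu}(-t^{-\nu})$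 converges absolutely, and $$f_{\nu,\mu}(t)=t^{\mu-1}\,W_{-\nu,\mu}\bigl(-t^{-\nu}\bigr).$$ (d) For $\mu=1-\nu$, $$f_{\nu,1-\nu}(t)=\frac1\nu\,F_\nu\bigl(t^{-\nu}\bigr)=t^{-\nu}\,M_\nu\bigl(t^{-\nu}\bigr).$$ -/

import Mathlib

open MeasureTheory

/-- The integrand `e^{s t} F(s)` of the Bromwich integral. -/
noncomputable def bromwichIntegrand (F : ℂ → ℂ) (t : ℝ) (s : ℂ) : ℂ :=
  Complex.exp (s * t) * F s

/-- The complex inversion formula `(1 / (2 π i)) ∫_{c - i∞}^{c + i∞} e^{s t} F(s) ds`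
for the Laplace transform, along the vertical line `s = c + i y` (so that `ds = i dy`). -/
noncomputable def inverseLaplace (c : ℝ) (F : ℂ → ℂ) (t : ℝ) : ℂ :=
  1 / (2 * Real.pi * Complex.I) *
    ∫ y : ℝ, bromwichIntegrand F t (c + y * Complex.I) * Complex.I

/-- `F(s) = s^{-μ} exp (-s^ν)`, with the principal branch of the powers
(cut along the negative real axis). -/
noncomputable def stretchedExpTransform (ν μ : ℝ) (s : ℂ) : ℂ :=
  s ^ (-μ : ℂ) * Complex.exp (-s ^ (ν : ℂ))

/-- `f_{ν,μ}(t)`, the inverse Laplace transform of `s^{-μ} exp (-s^ν)`, computed along the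
line `Re s = c`. -/
noncomputable def fInv (c ν μ t : ℝ) : ℂ :=
  inverseLaplace c (stretchedExpTransform ν μ) t

/-- The `k`-th term `z^k / (k! Γ(lam k + μ))` of the Wright series. At a pole of `Γ`, Mathlib's
value is `Γ = 0`, so that the term is `0`, in accordance with the convention `1 / Γ = 0` there. -/
noncomputable def wrightTerm (lam : ℝ) (μ z : ℂ) (k : ℕ) : ℂ :=
  z ^ k / ((k.factorial : ℂ) * Complex.Gamma (lam * k + μ))

/-- The Wright function `W_{lam,μ}(z) = ∑_{k ≥ 0} z^k / (k! Γ(lam k + μ))`, `lam > -1`. -/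
noncomputable def wright (lam : ℝ) (μ z : ℂ) : ℂ :=
  ∑' k : ℕ, wrightTerm lam μ z k

/-- The Mainardi function `F_ν(z) = W_{-ν,0}(-z)`. -/
noncomputable def mainardiF (ν : ℝ) (z : ℂ) : ℂ :=
  wright (-ν) 0 (-z)

/-- The Mainardi function `M_ν(z) = W_{-ν,1-ν}(-z)`. -/
noncomputable def mainardiM (ν : ℝ) (z : ℂ) : ℂ :=
  wright (-ν) (1 - ν) (-z)

/-- The real integrand
`u^{-μ} exp (-u t - u^ν cos (π ν)) sin (u^ν sin (π ν) + π μ)`. -/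
noncomputable def realIntegrand (ν μ t u : ℝ) : ℝ :=
  u ^ (-μ) * Real.exp (-(u * t) - u ^ ν * Real.cos (Real.pi * ν)) *
    Real.sin (u ^ ν * Real.sin (Real.pi * ν) + Real.pi * μ)

/-! Everything rests on one contour deformation and one power series. Choose `θ` with `π/2 < θ < π`
and `θν < π/2`. In the sector `|arg s| ≤ θ` the factor `e^{-s^ν}` decays like `exp(-δ|s|^ν)` with `δ
> 0`, which beats every power of `s`. Hence the Bromwich integral converges absolutely for every
real `μ`, and Cauchy's theorem bends the vertical line into the two rays `c + r e^{±iθ}`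
(`exists_sector_bromwich`).

On these rays `e^{st}` decays exponentially, so `e^{-s^ν}` may be expanded and integrated term by
term; on the vertical line `|e^{st}|` is constant and the terms with large `k` would not be
integrable. Each term is a Hankel integral of `e^{st} s^{-z}` with `z = μ - νk`, equal to `2πi
t^{z-1}/Γ(z)` (`rayIntegral_exp_mul_cpow_sub`). Summation gives the Wright series (`hasSum_fInv`).
Hankel's formula comes from Fourier inversion for `z ≥ 2` and descends to all real `z` by
integration by parts.

The real integral is not obtained by collapsing the contour onto the cut. For `μ < 1` its integrand
is expanded too, Euler's integral and the reflection formula evaluate each term, and the same series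
appears (`hasSum_integral_realIntegrand`). The Mainardi forms are the case `μ = 1 - ν` together with
an index shift relating `F_ν` to `M_ν`. -/

open Filter Topology Set Complex

/-! ### Integrals along rays and Cauchy's theorem in a sector -/

/-- The integral of `G` along the ray `c + r e^{iφ}`, `r > 0`. -/
noncomputable def rayIntegral (G : ℂ → ℂ) (c φ : ℝ) : ℂ :=
  ∫ r in Ioi (0 : ℝ), G (c + r * exp (φ * I)) * exp (φ * I)

lemma integral_Ioi_eq_integral_exp (g : ℝ → ℂ) :
    ∫ r in Ioi (0 : ℝ), g r = ∫ x : ℝ, (Real.exp x : ℂ) * g (Real.exp x) := by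
  have h := integral_image_eq_integral_abs_deriv_smul (s := univ) (f := Real.exp)
    (f' := Real.exp) MeasurableSet.univ
    (fun x _ => (Real.hasDerivAt_exp x).hasDerivWithinAt) Real.exp_injective.injOn g
  rw [image_univ, Real.range_exp] at h
  simpa [abs_of_pos (Real.exp_pos _), Complex.real_smul] using h

lemma integrable_exp_div_one_add_sq :
    Integrable (fun x : ℝ => Real.exp x * (1 + Real.exp x ^ 2)⁻¹) := by
  have h := integrableOn_image_iff_integrableOn_abs_deriv_smul (s := univ) (f := Real.exp)
    (f' := Real.exp) MeasurableSet.univ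
    (fun x _ => (Real.hasDerivAt_exp x).hasDerivWithinAt) Real.exp_injective.injOn
    (fun r : ℝ => (1 + r ^ 2)⁻¹)
  have h2 := h.1 integrable_inv_one_add_sq.integrableOn
  simpa [abs_of_pos (Real.exp_pos _)] using h2

lemma tendsto_exp_div_one_add_sq_atTop :
    Tendsto (fun x : ℝ => Real.exp x * (1 + Real.exp x ^ 2)⁻¹) atTop (𝓝 0) := by
  refine squeeze_zero (fun x => by positivity) (fun x => ?_) (Real.tendsto_exp_neg_atTop_nhds_zero)
  rw [← div_eq_mul_inv, div_le_iff₀ (by positivity), Real.exp_neg]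
  have := Real.exp_pos x
  field_simp
  nlinarith

lemma tendsto_exp_div_one_add_sq_atBot :
    Tendsto (fun x : ℝ => Real.exp x * (1 + Real.exp x ^ 2)⁻¹) atBot (𝓝 0) := by
  refine squeeze_zero (fun x => by positivity) (fun x => ?_) (Real.tendsto_exp_atBot)
  have := Real.exp_pos x
  rw [← div_eq_mul_inv, div_le_iff₀ (by positivity)]
  nlinarith [pow_pos this 3]

lemma rayIntegral_eq_integral_exp (G : ℂ → ℂ) (c φ : ℝ) :
    rayIntegral G c φ = ∫ x : ℝ, G (c + exp (x + φ * I)) * exp (x + φ * I) := by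
  rw [rayIntegral, integral_Ioi_eq_integral_exp]
  refine integral_congr_ae (Eventually.of_forall fun x => ?_)
  simp only [Complex.exp_add, ofReal_exp]
  ring

/-- A function holomorphic in a sector with vertex `c` that decays like `r⁻²` has the same
integral along all rays of the sector. -/
theorem rayIntegral_eq_of_bound {G : ℂ → ℂ} {c θ₁ θ₂ C : ℝ} (hθ : θ₁ ≤ θ₂)
    (hd : ∀ r > (0 : ℝ), ∀ φ ∈ Icc θ₁ θ₂, DifferentiableAt ℂ G (c + r * exp (φ * I)))
    (hb : ∀ r > (0 : ℝ), ∀ φ ∈ Icc θ₁ θ₂,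
      ‖G (c + r * exp (φ * I))‖ ≤ C * (1 + r ^ 2)⁻¹) :
    rayIntegral G c θ₁ = rayIntegral G c θ₂ := by
  -- In the coordinate `w = log (s - c)` the sector becomes the horizontal strip `θ₁ ≤ Im w ≤ θ₂`,
  -- so Cauchy's theorem for rectangles suffices: horizontal sides are rays, vertical sides are
  -- arcs. The vertex goes to `-∞`, hence no regularity is needed there.
  set K : ℂ → ℂ := fun w => G (c + exp w) * exp w with hK
  have hw : ∀ x φ : ℝ, exp (x + φ * I) = (Real.exp x : ℝ) * exp (φ * I) := fun x φ => by
    rw [Complex.exp_add, ofReal_exp]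
  have hnorm : ∀ x φ : ℝ, ‖exp (x + φ * I)‖ = Real.exp x := fun x φ => by
    rw [Complex.norm_exp]; simp
  have hKd : ∀ x φ : ℝ, φ ∈ Icc θ₁ θ₂ → DifferentiableAt ℂ K (x + φ * I) := by
    intro x φ hφ
    have h1 : DifferentiableAt ℂ G (c + exp (x + φ * I)) := by
      rw [hw]; exact hd _ (Real.exp_pos x) φ hφ
    have h2 : DifferentiableAt ℂ (fun w : ℂ => G (c + exp w)) (x + φ * I) :=
      DifferentiableAt.comp (g := G) (f := fun w : ℂ => c + exp w) (x + φ * I) h1 (by fun_prop)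
    exact h2.mul (by fun_prop)
  have hKb : ∀ x φ : ℝ, φ ∈ Icc θ₁ θ₂ →
      ‖K (x + φ * I)‖ ≤ C * (Real.exp x * (1 + Real.exp x ^ 2)⁻¹) := by
    intro x φ hφ
    simp only [hK]
    rw [norm_mul, hnorm, hw]
    have := mul_le_mul_of_nonneg_right (hb _ (Real.exp_pos x) φ hφ) (Real.exp_pos x).le
    linarith
  have hKi : ∀ φ : ℝ, φ ∈ Icc θ₁ θ₂ → Integrable (fun x : ℝ => K (x + φ * I)) := by
    intro φ hφ
    refine (integrable_exp_div_one_add_sq.const_mul C).mono' ?_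
      (Eventually.of_forall fun x => hKb x φ hφ)
    refine Continuous.aestronglyMeasurable (continuous_iff_continuousAt.2 fun x => ?_)
    exact ContinuousAt.comp (g := K) (f := fun x : ℝ => (x : ℂ) + φ * I)
      (hKd x φ hφ).continuousAt (by fun_prop)
  have hlim : ∀ φ : ℝ, φ ∈ Icc θ₁ θ₂ →
      Tendsto (fun A : ℝ => ∫ x in (-A)..A, K (x + φ * I)) atTop (𝓝 (rayIntegral G c φ)) := by
    intro φ hφ
    rw [rayIntegral_eq_integral_exp]
    exact intervalIntegral_tendsto_integral (hKi φ hφ) tendsto_neg_atTop_atBot tendsto_id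
  -- Arcs of radius `e^x` contribute at most a multiple of `e^x / (1 + e^{2x})`, which vanishes both
  -- for large and for small radius.
  have hside : ∀ l : Filter ℝ,
      Tendsto (fun x : ℝ => Real.exp x * (1 + Real.exp x ^ 2)⁻¹) l (𝓝 0) →
      Tendsto (fun x : ℝ => I • ∫ y in θ₁..θ₂, K (x + y * I)) l (𝓝 0) := by
    intro l hl
    have h0 : Tendsto (fun x : ℝ => C * (Real.exp x * (1 + Real.exp x ^ 2)⁻¹) * |θ₂ - θ₁|) l
        (𝓝 0) := by simpa using (hl.const_mul C).mul_const |θ₂ - θ₁|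
    refine squeeze_zero_norm (fun x => ?_) h0
    rw [norm_smul, norm_I, one_mul]
    refine intervalIntegral.norm_integral_le_of_norm_le_const fun y hy => hKb x y ?_
    rw [uIoc_of_le hθ] at hy
    exact Ioc_subset_Icc_self hy
  have hrect : ∀ A : ℝ, (∫ x in (-A)..A, K (x + θ₁ * I)) - (∫ x in (-A)..A, K (x + θ₂ * I)) +
      I • (∫ y in θ₁..θ₂, K (A + y * I)) -
      I • (∫ y in θ₁..θ₂, K ((-A : ℝ) + y * I)) = 0 := by
    intro A
    have := integral_boundary_rect_eq_zero_of_differentiableOn K ⟨-A, θ₁⟩ ⟨A, θ₂⟩ (by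
      rintro w ⟨-, hw2⟩
      simp only [mem_preimage, uIcc_of_le hθ] at hw2
      have := hKd w.re w.im hw2
      rw [re_add_im] at this
      exact this.differentiableWithinAt)
    simpa using this
  have hl := ((((hlim θ₁ ⟨le_rfl, hθ⟩).sub (hlim θ₂ ⟨hθ, le_rfl⟩)).add
    (hside _ tendsto_exp_div_one_add_sq_atTop)).sub
    ((hside _ tendsto_exp_div_one_add_sq_atBot).comp tendsto_neg_atTop_atBot))
  have := tendsto_nhds_unique (hl.congr hrect) tendsto_const_nhds
  simpa [sub_eq_zero] using this

/-- A vertical line consists of the two rays with directions `±π/2`. -/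
theorem integral_vertical_line_eq_rayIntegral {G : ℂ → ℂ} {c : ℝ}
    (hi : Integrable (fun y : ℝ => G (c + y * I))) :
    ∫ y : ℝ, G (c + y * I) * I =
      rayIntegral G c (Real.pi / 2) - rayIntegral G c (-(Real.pi / 2)) := by
  have h1 : exp (((Real.pi / 2 : ℝ) : ℂ) * I) = I := by
    push_cast; exact exp_pi_div_two_mul_I
  have h2 : exp (((-(Real.pi / 2) : ℝ) : ℂ) * I) = -I := by
    push_cast; rw [← neg_div]; exact exp_neg_pi_div_two_mul_I
  have hi2 := hi.mul_const I
  rw [← intervalIntegral.integral_Iic_add_Ioi (b := 0) hi2.integrableOn hi2.integrableOn,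
    rayIntegral, rayIntegral, h1, h2, add_comm, sub_eq_add_neg, ← integral_neg]
  congr 1
  have := integral_comp_neg_Ioi (0 : ℝ) (fun y : ℝ => G (c + y * I) * I)
  rw [neg_zero] at this
  rw [← this]
  refine integral_congr_ae (Eventually.of_forall fun x => ?_)
  simp

/-! ### Growth and decay of powers against exponentials -/

lemma exists_abs_le_of_tendsto_zero {f : ℝ → ℝ} {m : ℝ} (hf : ContinuousOn f (Ici m))
    (h0 : Tendsto f atTop (𝓝 0)) : ∃ C, 0 < C ∧ ∀ x, m ≤ x → |f x| ≤ C := by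
  have h1 : ∀ᶠ x in atTop, |f x| < 1 := h0.abs.eventually_lt_const (by simp)
  obtain ⟨N, hN⟩ := eventually_atTop.1 h1
  obtain ⟨D, hD⟩ := isCompact_Icc.exists_bound_of_continuousOn
    (hf.mono (Icc_subset_Ici_self : Icc m N ⊆ _))
  refine ⟨max D 1, by positivity, fun x hx => ?_⟩
  rcases le_total x N with h | h
  · exact (hD x ⟨hx, h⟩).trans (le_max_left _ _)
  · exact (hN x h).le.trans (le_max_right _ _)

/-- A power with exponent in `(0, 1)` is dominated by a linear function of small slope. -/
lemma exists_rpow_le_add_mul {ν ε : ℝ} (hν0 : 0 < ν) (hν1 : ν < 1) (hε : 0 < ε) :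
    ∃ K, ∀ x, 0 ≤ x → x ^ ν ≤ K + ε * x := by
  -- `X` is the crossover point `X^ν = εX`: the constant wins below it, the linear term above it.
  set X : ℝ := (ε⁻¹) ^ (1 / (1 - ν)) with hX
  have hX0 : 0 < X := by positivity
  refine ⟨X ^ ν, fun x hx => ?_⟩
  rcases le_total x X with h | h
  · have := Real.rpow_le_rpow hx h hν0.le
    nlinarith [mul_nonneg hε.le hx]
  · have hx0 : 0 < x := hX0.trans_le h
    have h1 : ε⁻¹ ≤ x ^ (1 - ν) := by
      have := Real.rpow_le_rpow hX0.le h (by linarith : 0 ≤ 1 - ν)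
      rwa [hX, ← Real.rpow_mul (by positivity), one_div_mul_cancel (by linarith),
        Real.rpow_one] at this
    have h2 : x = x ^ ν * x ^ (1 - ν) := by
      rw [← Real.rpow_add hx0]; simp
    have h3 : x ^ ν ≤ ε * x := by
      have hp : 0 < x ^ ν := by positivity
      calc x ^ ν = ε * (x ^ ν * ε⁻¹) := by field_simp
        _ ≤ ε * (x ^ ν * x ^ (1 - ν)) := by gcongr
        _ = ε * x := by rw [← h2]
    have : 0 < X ^ ν := by positivity
    linarith

/-- `x^{-μ} e^{x^ν}` grows at most like `e^{εx}`. -/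
lemma exists_rpow_mul_exp_rpow_le {ν ε m : ℝ} (hν0 : 0 < ν) (hν1 : ν < 1) (hε : 0 < ε)
    (hm : 0 < m) (μ : ℝ) :
    ∃ C, 0 < C ∧ ∀ x, m ≤ x → x ^ (-μ) * Real.exp (x ^ ν) ≤ C * Real.exp (ε * x) := by
  obtain ⟨K, hK⟩ := exists_rpow_le_add_mul hν0 hν1 (half_pos hε)
  have ht : Tendsto (fun x : ℝ => x ^ (-μ) / Real.exp (ε / 2 * x)) atTop (𝓝 0) :=
    (isLittleO_rpow_exp_pos_mul_atTop (-μ) (half_pos hε)).tendsto_div_nhds_zero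
  obtain ⟨C, hC0, hC⟩ := exists_abs_le_of_tendsto_zero (m := m) (by
    refine ContinuousOn.div (fun x hx => ?_) (by fun_prop) (fun x _ => (Real.exp_pos _).ne')
    exact (Real.continuousAt_rpow_const _ _ (Or.inl (hm.trans_le hx).ne')).continuousWithinAt) ht
  refine ⟨C * Real.exp K, by positivity, fun x hx => ?_⟩
  have hx0 : 0 < x := hm.trans_le hx
  have h1 := (le_abs_self _).trans (hC x hx)
  rw [div_le_iff₀ (Real.exp_pos _)] at h1
  calc x ^ (-μ) * Real.exp (x ^ ν)
      ≤ (C * Real.exp (ε / 2 * x)) * Real.exp (K + ε / 2 * x) := by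
        gcongr
        exact hK x hx0.le
    _ = C * Real.exp K * Real.exp (ε * x) := by
        rw [Real.exp_add, show ε * x = ε / 2 * x + ε / 2 * x by ring, Real.exp_add]; ring

/-- `x^{-μ} e^{-δ x^ν}` decays at least like `x⁻²`. -/
lemma exists_rpow_mul_exp_neg_rpow_le {ν δ m : ℝ} (hν0 : 0 < ν) (hδ : 0 < δ)
    (hm : 0 < m) (μ : ℝ) :
    ∃ C, 0 < C ∧ ∀ x, m ≤ x → x ^ (-μ) * Real.exp (-(δ * x ^ ν)) ≤ C * (x ^ 2)⁻¹ := by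
  -- In the variable `x^ν` the exponent `(2 - μ)/ν` produces `x^{2-μ}`, that is, `x^{-μ}` with the
  -- wanted factor `x²`.
  have ht : Tendsto (fun x : ℝ => (x ^ ν) ^ ((2 - μ) / ν) / Real.exp (δ * x ^ ν)) atTop (𝓝 0) :=
    (isLittleO_rpow_exp_pos_mul_atTop ((2 - μ) / ν) hδ).tendsto_div_nhds_zero.comp
      (tendsto_rpow_atTop hν0)
  have hc : ContinuousOn (fun x : ℝ => x ^ ν) (Ici m) := fun x hx =>
    (Real.continuousAt_rpow_const _ _ (Or.inl (hm.trans_le hx).ne')).continuousWithinAt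
  obtain ⟨C, hC0, hC⟩ := exists_abs_le_of_tendsto_zero (m := m) (by
    refine ContinuousOn.div (hc.rpow_const fun x hx => Or.inl ?_) (by fun_prop)
      (fun x _ => (Real.exp_pos _).ne')
    have := hm.trans_le hx
    positivity) ht
  refine ⟨C, hC0, fun x hx => ?_⟩
  have hx0 : 0 < x := hm.trans_le hx
  have h1 := (le_abs_self _).trans (hC x hx)
  rw [← Real.rpow_mul hx0.le, mul_div_cancel₀ _ hν0.ne', sub_eq_add_neg, Real.rpow_add hx0,
    Real.rpow_two, div_eq_mul_inv, ← Real.exp_neg] at h1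
  rw [← div_eq_mul_inv, le_div_iff₀ (by positivity)]
  linarith

/-! ### Sectors with vertex `c` and deformation of the vertical line -/

lemma normSq_add_mul_exp (c r φ : ℝ) :
    ‖(c : ℂ) + r * exp (φ * I)‖ ^ 2 = c ^ 2 + r ^ 2 + 2 * c * r * Real.cos φ := by
  rw [← normSq_eq_norm_sq, normSq_apply]
  simp only [add_re, ofReal_re, re_ofReal_mul, exp_ofReal_mul_I_re, add_im, ofReal_im,
    im_ofReal_mul, exp_ofReal_mul_I_im]
  linear_combination r ^ 2 * Real.sin_sq_add_cos_sq φ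

/-- Away from the negative direction, the points of a sector with vertex `c > 0` stay away from
the origin and grow linearly along rays. -/
lemma exists_le_norm_add_mul_exp {c θ : ℝ} (hc : 0 < c) (h0 : 0 < θ) (hπ : θ < Real.pi) :
    ∃ κ > 0, ∀ r φ : ℝ, 0 ≤ r → |φ| ≤ θ →
      κ * (1 + r ^ 2) ≤ ‖(c : ℂ) + r * exp (φ * I)‖ ^ 2 := by
  have h1 : |Real.cos θ| < 1 := by
    rw [abs_lt]
    constructor
    · rw [← Real.cos_pi]
      exact Real.cos_lt_cos_of_nonneg_of_le_pi h0.le le_rfl hπ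
    · rw [← Real.cos_zero]
      exact Real.cos_lt_cos_of_nonneg_of_le_pi le_rfl hπ.le h0
  -- With `q = |cos θ|`, the identity `c² + r² - 2crq = (1 - q)(c² + r²) + q(c - r)²` supplies the
  -- first factor; the minimum compares `c² + r²` with `1 + r²`.
  refine ⟨(1 - |Real.cos θ|) * min 1 (c ^ 2), mul_pos (by linarith) (by positivity), ?_⟩
  intro r φ hr hφ
  have h2 : Real.cos θ ≤ Real.cos φ := by
    rw [← Real.cos_abs φ]
    exact Real.cos_le_cos_of_nonneg_of_le_pi (abs_nonneg _) hπ.le hφ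
  have h3 : -|Real.cos θ| ≤ Real.cos φ := (neg_abs_le _).trans h2
  rw [normSq_add_mul_exp]
  have h4 : min 1 (c ^ 2) * (1 + r ^ 2) ≤ c ^ 2 + r ^ 2 := by
    have := min_le_left 1 (c ^ 2)
    have := min_le_right 1 (c ^ 2)
    nlinarith [sq_nonneg r]
  calc _ = (1 - |Real.cos θ|) * (min 1 (c ^ 2) * (1 + r ^ 2)) := by ring
    _ ≤ (1 - |Real.cos θ|) * (c ^ 2 + r ^ 2) := by gcongr
    _ ≤ c ^ 2 + r ^ 2 + 2 * c * r * -|Real.cos θ| := by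
      nlinarith [mul_nonneg (abs_nonneg (Real.cos θ)) (sq_nonneg (c - r))]
    _ ≤ _ := by gcongr

lemma add_mul_exp_mem_slitPlane {c r φ : ℝ} (hc : 0 < c) (hr : 0 ≤ r) (hφ : |φ| < Real.pi) :
    (c : ℂ) + r * exp (φ * I) ∈ slitPlane := by
  rw [mem_slitPlane_iff]
  simp only [add_re, ofReal_re, re_ofReal_mul, exp_ofReal_mul_I_re, add_im, ofReal_im,
    im_ofReal_mul, exp_ofReal_mul_I_im]
  rw [abs_lt] at hφ
  by_cases h : r * Real.sin φ = 0
  · left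
    rcases mul_eq_zero.1 h with h | h
    · simp [h, hc]
    · rw [Real.sin_eq_zero_iff_of_lt_of_lt hφ.1 hφ.2] at h
      rw [h, Real.cos_zero]; linarith
  · right; simpa using h

/-- For a function that is holomorphic and decays quadratically in the sectors
`π/2 ≤ |φ| ≤ θ` with vertex `c`, the vertical line through `c` can be replaced by the two rays
with directions `±θ`. -/
theorem integral_vertical_line_eq_of_bound {G : ℂ → ℂ} {c θ C : ℝ} (hθ : Real.pi / 2 ≤ θ)
    (hd : ∀ r φ : ℝ, 0 ≤ r → Real.pi / 2 ≤ |φ| → |φ| ≤ θ →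
      DifferentiableAt ℂ G (c + r * exp (φ * I)))
    (hb : ∀ r φ : ℝ, 0 ≤ r → Real.pi / 2 ≤ |φ| → |φ| ≤ θ →
      ‖G (c + r * exp (φ * I))‖ ≤ C * (1 + r ^ 2)⁻¹) :
    Integrable (fun y : ℝ => G (c + y * I)) ∧
      ∫ y : ℝ, G (c + y * I) * I = rayIntegral G c θ - rayIntegral G c (-θ) := by
  have hpi : 0 < Real.pi / 2 := by positivity
  have hy : ∀ y : ℝ, ∃ φ : ℝ, |φ| = Real.pi / 2 ∧
      (c : ℂ) + y * I = c + (|y| : ℝ) * exp (φ * I) := by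
    intro y
    rcases le_total 0 y with h | h
    · refine ⟨Real.pi / 2, abs_of_pos hpi, ?_⟩
      rw [abs_of_nonneg h]; push_cast; rw [exp_pi_div_two_mul_I]
    · refine ⟨-(Real.pi / 2), by rw [abs_neg, abs_of_pos hpi], ?_⟩
      rw [abs_of_nonpos h]; push_cast; rw [← neg_div, exp_neg_pi_div_two_mul_I]; ring
  have hi : Integrable (fun y : ℝ => G (c + y * I)) := by
    refine (integrable_inv_one_add_sq.const_mul C).mono' ?_ (Eventually.of_forall fun y => ?_)
    · refine Continuous.aestronglyMeasurable (continuous_iff_continuousAt.2 fun y => ?_)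
      refine ContinuousAt.comp (g := G) (f := fun y : ℝ => (c : ℂ) + y * I) ?_ (by fun_prop)
      obtain ⟨φ, hφ, h⟩ := hy y
      simpa only [h] using (hd |y| φ (abs_nonneg y) hφ.ge (hφ.le.trans hθ)).continuousAt
    · obtain ⟨φ, hφ, h⟩ := hy y
      simpa only [h, sq_abs] using hb |y| φ (abs_nonneg y) hφ.ge (hφ.le.trans hθ)
  refine ⟨hi, ?_⟩
  have hup : ∀ φ ∈ Icc (Real.pi / 2) θ, Real.pi / 2 ≤ |φ| ∧ |φ| ≤ θ := fun φ hφ => by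
    rwa [abs_of_pos (hpi.trans_le hφ.1)]
  have hlow : ∀ φ ∈ Icc (-θ) (-(Real.pi / 2)), Real.pi / 2 ≤ |φ| ∧ |φ| ≤ θ := fun φ hφ => by
    rw [abs_of_neg (by linarith [hφ.2])]
    constructor <;> linarith [hφ.1, hφ.2]
  rw [integral_vertical_line_eq_rayIntegral hi,
    rayIntegral_eq_of_bound hθ (C := C)
      (fun r hr φ hφ => hd r φ (le_of_lt hr) (hup φ hφ).1 (hup φ hφ).2)
      (fun r hr φ hφ => hb r φ (le_of_lt hr) (hup φ hφ).1 (hup φ hφ).2),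
    rayIntegral_eq_of_bound (θ₁ := -θ) (θ₂ := -(Real.pi / 2)) (by linarith) (C := C)
      (fun r hr φ hφ => hd r φ (le_of_lt hr) (hlow φ hφ).1 (hlow φ hφ).2)
      (fun r hr φ hφ => hb r φ (le_of_lt hr) (hlow φ hφ).1 (hlow φ hφ).2)]

lemma add_mul_exp_re_mul (c r φ t : ℝ) :
    (((c : ℂ) + r * exp (φ * I)) * t).re = (c + r * Real.cos φ) * t := by
  rw [mul_comm, re_ofReal_mul, add_re, ofReal_re, re_ofReal_mul, exp_ofReal_mul_I_re]; ring

/-- The case of an integrand `e^{st} F(s)` where `F` is holomorphic in the slit plane. -/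
theorem integral_vertical_line_exp_mul_eq {F : ℂ → ℂ} {c t θ C : ℝ} (ht : 0 < t)
    (hc : 0 < c) (hθ : Real.pi / 2 ≤ θ) (hθπ : θ < Real.pi) (hF : DifferentiableOn ℂ F slitPlane)
    (hb : ∀ r φ : ℝ, 0 ≤ r → |φ| ≤ θ → ‖F (c + r * exp (φ * I))‖ ≤ C * (1 + r ^ 2)⁻¹) :
    Integrable (fun y : ℝ => exp ((c + y * I) * t) * F (c + y * I)) ∧
      ∫ y : ℝ, exp ((c + y * I) * t) * F (c + y * I) * I =
        rayIntegral (fun s => exp (s * t) * F s) c θ -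
          rayIntegral (fun s => exp (s * t) * F s) c (-θ) := by
  refine integral_vertical_line_eq_of_bound (G := fun s => exp (s * t) * F s)
    (C := Real.exp (c * t) * C) hθ (fun r φ hr _ hφ => ?_) (fun r φ hr hφ1 hφ => ?_)
  · refine DifferentiableAt.mul (by fun_prop) (hF.differentiableAt (isOpen_slitPlane.mem_nhds ?_))
    exact add_mul_exp_mem_slitPlane hc hr (hφ.trans_lt hθπ)
  · rw [norm_mul, norm_exp, add_mul_exp_re_mul, mul_assoc]
    -- Only the part of the sector left of the line is swept, and there `|e^{st}| ≤ e^{ct}`.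
    have hcos : Real.cos φ ≤ 0 := by
      rw [← Real.cos_abs]
      exact Real.cos_nonpos_of_pi_div_two_le_of_le hφ1 (by linarith)
    have : (c + r * Real.cos φ) * t ≤ c * t := by
      have := mul_nonneg hr (neg_nonneg.2 hcos)
      gcongr
      linarith
    gcongr
    exact hb r φ hr hφ

/-! ### Laplace transform of a power and its inversion -/

lemma exists_rpow_mul_exp_neg_mul_le {a δ : ℝ} (ha : 0 ≤ a) (hδ : 0 < δ) :
    ∃ C, ∀ r, 0 ≤ r → r ^ a * Real.exp (-(δ * r)) ≤ C * (1 + r ^ 2)⁻¹ := by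
  have ht : Tendsto (fun x : ℝ => (x ^ a + x ^ (a + 2)) / Real.exp (δ * x)) atTop (𝓝 0) := by
    simpa [add_div] using
      (isLittleO_rpow_exp_pos_mul_atTop a hδ).tendsto_div_nhds_zero.add
        (isLittleO_rpow_exp_pos_mul_atTop (a + 2) hδ).tendsto_div_nhds_zero
  obtain ⟨C, -, hC⟩ := exists_abs_le_of_tendsto_zero (m := 0) (by
    refine (Continuous.div ?_ (by fun_prop) (fun x => (Real.exp_pos _).ne')).continuousOn
    exact (Real.continuous_rpow_const ha).add (Real.continuous_rpow_const (by linarith))) ht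
  refine ⟨C, fun r hr => ?_⟩
  have h1 := (le_abs_self _).trans (hC r hr)
  rw [Real.rpow_add_of_nonneg hr ha (by norm_num), Real.rpow_two, div_eq_mul_inv,
    ← Real.exp_neg] at h1
  rw [← div_eq_mul_inv, le_div_iff₀ (by positivity)]
  linarith

/-- The Gamma integral may be taken along any ray in the right half plane. -/
lemma rayIntegral_cpow_mul_exp_neg {z φ : ℝ} (hz : 1 < z) (hφ : |φ| < Real.pi / 2) :
    rayIntegral (fun s => s ^ ((z : ℂ) - 1) * exp (-s)) 0 φ = Gamma z := by
  have h0 : rayIntegral (fun s => s ^ ((z : ℂ) - 1) * exp (-s)) 0 0 = Gamma z := by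
    rw [Complex.Gamma_eq_integral (by simpa using by linarith), Complex.GammaIntegral, rayIntegral]
    refine setIntegral_congr_fun measurableSet_Ioi fun x hx => ?_
    simp
    ring
  have hcos : 0 < Real.cos φ := Real.cos_pos_of_mem_Ioo (abs_lt.1 hφ)
  -- Among directions `ψ` with `|ψ| ≤ |φ|`, decay is slowest at the edge, so the rate `cos φ` serves
  -- the whole sector.
  obtain ⟨C, hC⟩ := exists_rpow_mul_exp_neg_mul_le (by linarith : 0 ≤ z - 1) hcos
  have hd : ∀ r > (0 : ℝ), ∀ ψ : ℝ, |ψ| ≤ |φ| →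
      DifferentiableAt ℂ (fun s : ℂ => s ^ ((z : ℂ) - 1) * exp (-s))
        ((0 : ℝ) + r * exp (ψ * I)) := by
    intro r hr ψ hψ
    have : ((0 : ℝ) : ℂ) + r * exp (ψ * I) ∈ slitPlane := by
      rw [mem_slitPlane_iff]
      left
      simp only [add_re, ofReal_re, re_ofReal_mul, exp_ofReal_mul_I_re, zero_add]
      exact mul_pos hr (Real.cos_pos_of_mem_Ioo (abs_lt.1 (hψ.trans_lt hφ)))
    exact (differentiableAt_id.cpow_const this).mul (by fun_prop)
  have hb : ∀ r > (0 : ℝ), ∀ ψ : ℝ, |ψ| ≤ |φ| →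
      ‖(fun s : ℂ => s ^ ((z : ℂ) - 1) * exp (-s)) ((0 : ℝ) + r * exp (ψ * I))‖ ≤
        C * (1 + r ^ 2)⁻¹ := by
    intro r hr ψ hψ
    refine le_trans ?_ (hC r hr.le)
    have h1 : ((z : ℂ) - 1) = ((z - 1 : ℝ) : ℂ) := by push_cast; rfl
    have h2 : Real.cos φ ≤ Real.cos ψ := by
      rw [← Real.cos_abs φ, ← Real.cos_abs ψ]
      exact Real.cos_le_cos_of_nonneg_of_le_pi (abs_nonneg _)
        (by linarith [Real.pi_pos]) hψ
    simp only [ofReal_zero, zero_add, h1]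
    rw [norm_mul, norm_cpow_real, norm_exp, norm_mul, norm_exp_ofReal_mul_I, mul_one,
      Complex.norm_of_nonneg hr.le, neg_re, re_ofReal_mul, exp_ofReal_mul_I_re]
    rw [mul_comm r (Real.cos ψ)]
    gcongr
  rw [← h0]
  rcases le_total 0 φ with h | h
  · refine (rayIntegral_eq_of_bound h (C := C) (fun r hr ψ hψ => hd r hr ψ ?_)
      (fun r hr ψ hψ => hb r hr ψ ?_)).symm <;>
    · rw [abs_of_nonneg hψ.1, abs_of_nonneg h]; exact hψ.2
  · refine rayIntegral_eq_of_bound h (C := C) (fun r hr ψ hψ => hd r hr ψ ?_)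
      (fun r hr ψ hψ => hb r hr ψ ?_) <;>
    · rw [abs_of_nonpos hψ.2, abs_of_nonpos h]; linarith [hψ.1]

lemma ofReal_mul_cpow {r : ℝ} (hr : 0 < r) {s : ℂ} (hs : s ≠ 0) (a : ℂ) :
    ((r : ℂ) * s) ^ a = (r : ℂ) ^ a * s ^ a := by
  have hr' : (r : ℂ) ≠ 0 := ofReal_ne_zero.2 hr.ne'
  rw [cpow_def_of_ne_zero (mul_ne_zero hr' hs), cpow_def_of_ne_zero hr', cpow_def_of_ne_zero hs,
    log_ofReal_mul hr hs, ofReal_log hr.le, add_mul, Complex.exp_add]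

/-- The Laplace transform of `x^{z-1}`. -/
lemma integral_cpow_mul_exp_neg_mul_of_re_pos {z : ℝ} (hz : 1 < z) {p : ℂ} (hp : 0 < p.re) :
    ∫ x in Ioi (0 : ℝ), (x : ℂ) ^ ((z : ℂ) - 1) * exp (-(p * x)) = Gamma z * p ^ (-z : ℂ) := by
  have hp0 : p ≠ 0 := by rintro rfl; simp at hp
  have hn : 0 < ‖p‖ := norm_pos_iff.2 hp0
  have hφ : |arg p| < Real.pi / 2 := abs_arg_lt_pi_div_two_iff.2 (Or.inl hp)
  have h1 := rayIntegral_cpow_mul_exp_neg hz hφ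
  -- The substitution `s = px` turns the integral into the Gamma integral along the ray of direction
  -- `arg p`; `‖p‖` is the scaling of the radius.
  have h2 := integral_comp_mul_left_Ioi (fun r : ℝ => (fun s : ℂ => s ^ ((z : ℂ) - 1) * exp (-s))
    ((0 : ℝ) + r * exp (arg p * I)) * exp (arg p * I)) 0 hn
  rw [mul_zero] at h2
  have h4 : ∫ x in Ioi (0 : ℝ), (fun s : ℂ => s ^ ((z : ℂ) - 1) * exp (-s))
      ((0 : ℝ) + (‖p‖ * x : ℝ) * exp (arg p * I)) * exp (arg p * I) =
      (p ^ (z : ℂ) / ‖p‖) * ∫ x in Ioi (0 : ℝ), (x : ℂ) ^ ((z : ℂ) - 1) * exp (-(p * x)) := by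
    rw [← integral_const_mul]
    refine setIntegral_congr_fun measurableSet_Ioi fun x hx => ?_
    have h5 : ((‖p‖ * x : ℝ) : ℂ) * exp (arg p * I) = x * p := by
      conv_rhs => rw [← norm_mul_exp_arg_mul_I p]
      push_cast; ring
    have h6 : exp (arg p * I) = p / ‖p‖ := by
      rw [eq_div_iff (ofReal_ne_zero.2 hn.ne'), mul_comm, norm_mul_exp_arg_mul_I]
    simp only [h5, ofReal_zero, zero_add]
    rw [ofReal_mul_cpow hx hp0, h6, cpow_sub _ _ hp0, cpow_one, mul_comm (x : ℂ) p]
    field_simp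
  have h3 : (‖p‖⁻¹ : ℝ) • Gamma (z : ℂ) =
      (p ^ (z : ℂ) / ‖p‖) * ∫ x in Ioi (0 : ℝ), (x : ℂ) ^ ((z : ℂ) - 1) * exp (-(p * x)) := by
    rw [← h1, ← h4]; exact h2.symm
  have hpz : p ^ (z : ℂ) ≠ 0 := by simp [cpow_eq_zero_iff, hp0]
  have hn' : (‖p‖ : ℂ) ≠ 0 := ofReal_ne_zero.2 hn.ne'
  rw [real_smul, ofReal_inv] at h3
  rw [cpow_neg]
  field_simp at h3 ⊢
  rw [h3]

lemma norm_cpow_neg_le {z m : ℝ} (hz : 2 ≤ z) (hm : 0 < m) {s : ℂ} (hs : m ≤ ‖s‖) :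
    ‖s ^ (-z : ℂ)‖ ≤ m ^ (2 - z) * (‖s‖ ^ 2)⁻¹ := by
  have h0 : 0 < ‖s‖ := hm.trans_le hs
  rw [← ofReal_neg, norm_cpow_real, show -z = (2 - z) + (-2) by ring, Real.rpow_add h0,
    Real.rpow_neg h0.le, Real.rpow_two]
  gcongr 1
  exact Real.rpow_le_rpow_of_nonpos hm hs (by linarith)

open scoped FourierTransform in
/-- Complex inversion formula for the Laplace transform of `x^{z-1}`, `z ≥ 2`. -/
theorem integral_vertical_line_exp_mul_cpow {z c t : ℝ} (hz : 2 ≤ z) (hc : 0 < c) (ht : 0 < t)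
    (hi : Integrable (fun y : ℝ => ((c : ℂ) + y * I) ^ (-z : ℂ))) :
    Gamma z * ∫ y : ℝ, exp ((c + y * I) * t) * ((c : ℂ) + y * I) ^ (-z : ℂ) =
      2 * Real.pi * (t : ℂ) ^ ((z : ℂ) - 1) := by
  have hpi : (0 : ℝ) < 2 * Real.pi := by positivity
  -- The damping `e^{-cx}` makes the Fourier transform of `g` equal to `Γ(z)(c + 2πiξ)^{-z}`.
  -- Fourier inversion at `t` is then the Bromwich formula after rescaling `y = 2πξ`.
  set g : ℝ → ℂ := (Ioi (0 : ℝ)).indicator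
    (fun x => (x : ℂ) ^ ((z : ℂ) - 1) * exp (-(c * x))) with hg
  have hgi : Integrable g := by
    rw [hg, integrable_indicator_iff measurableSet_Ioi]
    have h1 := integrableOn_rpow_mul_exp_neg_mul_rpow (p := 1) (s := z - 1) (b := c)
      (by linarith) one_pos hc
    refine IntegrableOn.congr_fun h1.ofReal (fun x hx => ?_) measurableSet_Ioi
    have hx' : (0 : ℝ) ≤ x := le_of_lt hx
    simp [ofReal_cpow hx', neg_mul]
  have hF : ∀ ξ : ℝ, 𝓕 g ξ = Gamma z * ((c : ℂ) + (2 * Real.pi * ξ : ℝ) * I) ^ (-z : ℂ) := by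
    intro ξ
    rw [Real.fourier_real_eq_integral_exp_smul,
      ← integral_cpow_mul_exp_neg_mul_of_re_pos (by linarith) (by simpa using hc),
      ← integral_indicator measurableSet_Ioi]
    refine integral_congr_ae (Eventually.of_forall fun x => ?_)
    simp only [hg, smul_eq_mul, indicator_apply]
    split_ifs with h
    · rw [mul_left_comm, ← Complex.exp_add]
      congr 2
      push_cast; ring
    · simp
  have hFi : Integrable (𝓕 g) := by
    rw [show 𝓕 g = _ from funext hF]
    exact (hi.comp_mul_left' hpi.ne').const_mul _
  have hgc : ContinuousAt g t := by
    have h1 : ContinuousAt (fun x : ℝ => (x : ℂ) ^ ((z : ℂ) - 1) * exp (-(c * x))) t := by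
      refine ContinuousAt.mul ?_ (by fun_prop)
      exact continuousAt_ofReal_cpow_const t _ (Or.inr ht.ne')
    refine h1.congr ?_
    filter_upwards [Ioi_mem_nhds ht] with x hx
    rw [hg, indicator_of_mem hx]
  have hinv := hgi.fourierInv_fourier_eq hFi hgc
  rw [Real.fourierInv_eq', hg, indicator_of_mem (show t ∈ Ioi (0 : ℝ) from ht), ← hg] at hinv
  have hsub := Measure.integral_comp_mul_left (fun y : ℝ => exp (y * t * I) *
    (Gamma z * ((c : ℂ) + y * I) ^ (-z : ℂ))) (2 * Real.pi)
  have hinv2 : ∫ x : ℝ, exp ((2 * Real.pi * x : ℝ) * t * I) *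
      (Gamma z * ((c : ℂ) + (2 * Real.pi * x : ℝ) * I) ^ (-z : ℂ)) =
      (t : ℂ) ^ ((z : ℂ) - 1) * exp (-(c * t)) := by
    rw [← hinv]
    refine integral_congr_ae (Eventually.of_forall fun x => ?_)
    simp only [hF, smul_eq_mul]
    congr 2
    simp
    ring
  rw [hinv2, abs_of_pos (inv_pos.2 hpi), real_smul] at hsub
  have h3 : Gamma z * ∫ y : ℝ, exp ((c + y * I) * t) * ((c : ℂ) + y * I) ^ (-z : ℂ) =
      exp (c * t) * ∫ y : ℝ, exp (y * t * I) * (Gamma z * ((c : ℂ) + y * I) ^ (-z : ℂ)) := by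
    rw [← integral_const_mul, ← integral_const_mul]
    refine integral_congr_ae (Eventually.of_forall fun x => ?_)
    simp only
    rw [add_mul, Complex.exp_add, show (x : ℂ) * I * t = x * t * I by ring]
    ring
  have h4 : ∫ y : ℝ, exp (y * t * I) * (Gamma z * ((c : ℂ) + y * I) ^ (-z : ℂ)) =
      2 * Real.pi * ((t : ℂ) ^ ((z : ℂ) - 1) * exp (-(c * t))) := by
    rw [hsub, ← mul_assoc]
    push_cast
    rw [mul_inv_cancel₀ (by exact_mod_cast hpi.ne'), one_mul]
  rw [h3, h4, Complex.exp_neg]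
  have := Complex.exp_ne_zero (c * t)
  field_simp

/-! ### Hankel's formula on a V-shaped contour -/

lemma differentiableAt_exp_mul_cpow {s : ℂ} (hs : s ∈ slitPlane) (t : ℝ) (a : ℂ) :
    DifferentiableAt ℂ (fun s : ℂ => exp (s * t) * s ^ a) s :=
  DifferentiableAt.mul (by fun_prop) (differentiableAt_id.cpow_const hs)

/-- Exponential decay along the rays of the V-shaped contour. -/
lemma exists_norm_exp_mul_rpow_le {ν c t φ : ℝ} (hν0 : 0 < ν) (hν1 : ν < 1) (hc : 0 < c)
    (ht : 0 < t) (hφπ : |φ| < Real.pi) (hcos : Real.cos φ < 0) (μ : ℝ) :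
    ∃ C : ℝ, ∃ ε > (0 : ℝ), ∀ r : ℝ, 0 ≤ r →
      ‖exp (((c : ℂ) + r * exp (φ * I)) * t)‖ * (‖(c : ℂ) + r * exp (φ * I)‖ ^ (-μ) *
        Real.exp (‖(c : ℂ) + r * exp (φ * I)‖ ^ ν)) ≤ C * Real.exp (-ε * r) := by
  have hφ0 : 0 < |φ| := by
    rw [abs_pos]; rintro rfl; simp at hcos; linarith
  obtain ⟨κ, hκ, hlow⟩ := exists_le_norm_add_mul_exp hc hφ0 hφπ
  -- Half of the decay rate `-t cos φ` of `e^{st}` absorbs `|s|^{-μ} e^{|s|^ν}`; the other half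
  -- remains.
  have hε : 0 < -Real.cos φ * t / 2 := by have := mul_pos (neg_pos.2 hcos) ht; linarith
  obtain ⟨C, hC0, hC⟩ := exists_rpow_mul_exp_rpow_le hν0 hν1 hε (Real.sqrt_pos.2 hκ) μ
  refine ⟨Real.exp (c * t) * C * Real.exp (-Real.cos φ * t / 2 * c), _, hε, fun r hr => ?_⟩
  have hm : √κ ≤ ‖(c : ℂ) + r * exp (φ * I)‖ := by
    refine Real.sqrt_le_iff.2 ⟨norm_nonneg _, le_trans ?_ (hlow r φ hr le_rfl)⟩
    nlinarith [sq_nonneg r]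
  have hn : ‖(c : ℂ) + r * exp (φ * I)‖ ≤ c + r := by
    refine (norm_add_le _ _).trans_eq ?_
    rw [norm_mul, norm_exp_ofReal_mul_I, mul_one, Complex.norm_of_nonneg hc.le,
      Complex.norm_of_nonneg hr]
  rw [norm_exp, add_mul_exp_re_mul]
  calc _ ≤ Real.exp ((c + r * Real.cos φ) * t) *
        (C * Real.exp (-Real.cos φ * t / 2 * ‖(c : ℂ) + r * exp (φ * I)‖)) := by
        exact mul_le_mul_of_nonneg_left (hC _ hm) (Real.exp_pos _).le
    _ ≤ Real.exp ((c + r * Real.cos φ) * t) *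
        (C * Real.exp (-Real.cos φ * t / 2 * (c + r))) := by gcongr
    _ = _ := by
        rw [mul_left_comm, ← Real.exp_add, mul_comm (Real.exp (c * t)), mul_assoc, mul_assoc,
          ← Real.exp_add, ← Real.exp_add]
        ring_nf

lemma continuousOn_ray {E : Type*} [TopologicalSpace E] {c φ : ℝ} (hc : 0 < c)
    (hφπ : |φ| < Real.pi) {h : ℂ → E} (hh : ContinuousOn h slitPlane) :
    ContinuousOn (fun r : ℝ => h (c + r * exp (φ * I))) (Ici 0) :=
  hh.comp (f := fun r : ℝ => (c : ℂ) + r * exp (φ * I)) (by fun_prop)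
    fun _ hr => add_mul_exp_mem_slitPlane hc hr hφπ

lemma continuousOn_norm_rpow_slitPlane (a : ℝ) :
    ContinuousOn (fun s : ℂ => ‖s‖ ^ a) slitPlane := fun _ hs =>
  (continuous_norm.continuousAt.rpow_const
    (Or.inl (norm_ne_zero_iff.2 (slitPlane_ne_zero hs)))).continuousWithinAt

lemma integrableOn_ray_majorant {ν c t φ : ℝ} (hν0 : 0 < ν) (hν1 : ν < 1) (hc : 0 < c)
    (ht : 0 < t) (hφπ : |φ| < Real.pi) (hcos : Real.cos φ < 0) (μ : ℝ) :
    IntegrableOn (fun r : ℝ => ‖exp (((c : ℂ) + r * exp (φ * I)) * t)‖ *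
      (‖(c : ℂ) + r * exp (φ * I)‖ ^ (-μ) * Real.exp (‖(c : ℂ) + r * exp (φ * I)‖ ^ ν)))
      (Ioi 0) := by
  obtain ⟨C, ε, hε, hC⟩ := exists_norm_exp_mul_rpow_le hν0 hν1 hc ht hφπ hcos μ
  refine ((exp_neg_integrableOn_Ioi 0 hε).const_mul C).mono' ?_ ?_
  · refine ContinuousOn.aestronglyMeasurable ?_ measurableSet_Ioi
    refine (continuousOn_ray hc hφπ (h := fun s : ℂ => ‖exp (s * t)‖ *
      (‖s‖ ^ (-μ) * Real.exp (‖s‖ ^ ν))) ?_).mono Ioi_subset_Ici_self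
    refine ContinuousOn.mul (by fun_prop) ((continuousOn_norm_rpow_slitPlane _).mul ?_)
    exact Real.continuous_exp.comp_continuousOn (continuousOn_norm_rpow_slitPlane _)
  · refine (ae_restrict_iff' measurableSet_Ioi).2 (Eventually.of_forall fun r hr => ?_)
    rw [Real.norm_of_nonneg (by positivity)]
    exact hC r (le_of_lt hr)

/-- The factor `exp(|s|^ν) ≥ 1` costs nothing and lets the majorant of the exponential series also
control single powers. -/
lemma norm_exp_mul_cpow_le (s : ℂ) (ν t μ : ℝ) :
    ‖exp (s * t) * s ^ (-μ : ℂ)‖ ≤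
      ‖exp (s * t)‖ * (‖s‖ ^ (-μ) * Real.exp (‖s‖ ^ ν)) := by
  rw [norm_mul, ← ofReal_neg, norm_cpow_real]
  refine mul_le_mul_of_nonneg_left (le_mul_of_one_le_right (by positivity) ?_) (norm_nonneg _)
  exact Real.one_le_exp (by positivity)

lemma integrableOn_ray_exp_mul_cpow {c t φ : ℝ} (hc : 0 < c)
    (ht : 0 < t) (hφπ : |φ| < Real.pi) (hcos : Real.cos φ < 0) (μ : ℝ) :
    IntegrableOn (fun r : ℝ => exp (((c : ℂ) + r * exp (φ * I)) * t) *
      ((c : ℂ) + r * exp (φ * I)) ^ (-μ : ℂ)) (Ioi 0) := by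
  -- The value `1/2` is arbitrary; any exponent in `(0, 1)` would do.
  refine (integrableOn_ray_majorant (ν := 1 / 2) (by norm_num) (by norm_num) hc ht hφπ hcos μ).mono'
    ?_ (Eventually.of_forall fun r => norm_exp_mul_cpow_le _ _ _ _)
  refine ContinuousOn.aestronglyMeasurable ?_ measurableSet_Ioi
  exact (continuousOn_ray hc hφπ (h := fun s : ℂ => exp (s * t) * s ^ (-μ : ℂ)) fun _ hs =>
    (differentiableAt_exp_mul_cpow hs t _).continuousAt.continuousWithinAt).mono
    Ioi_subset_Ici_self

/-- Integration by parts along a ray. -/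
lemma rayIntegral_exp_mul_cpow_recursion {c t φ : ℝ} (hc : 0 < c)
    (ht : 0 < t) (hφπ : |φ| < Real.pi) (hcos : Real.cos φ < 0) (z : ℝ) :
    t * rayIntegral (fun s => exp (s * t) * s ^ (-z : ℂ)) c φ -
      z * rayIntegral (fun s => exp (s * t) * s ^ (-(z + 1 : ℝ) : ℂ)) c φ =
      -(exp (c * t) * (c : ℂ) ^ (-z : ℂ)) := by
  have hi1 := (integrableOn_ray_exp_mul_cpow hc ht hφπ hcos z).mul_const (exp (φ * I))
  have hi2 := (integrableOn_ray_exp_mul_cpow hc ht hφπ hcos (z + 1)).mul_const (exp (φ * I))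
  obtain ⟨C, ε, hε, hC⟩ := exists_norm_exp_mul_rpow_le (ν := 1 / 2) (by norm_num) (by norm_num)
    hc ht hφπ hcos z
  have hder : ∀ r ∈ Ici (0 : ℝ), HasDerivAt (fun r : ℝ => exp (((c : ℂ) + r * exp (φ * I)) * t) *
      ((c : ℂ) + r * exp (φ * I)) ^ (-z : ℂ))
      (t * (exp (((c : ℂ) + r * exp (φ * I)) * t) *
        ((c : ℂ) + r * exp (φ * I)) ^ (-z : ℂ) * exp (φ * I)) -
      z * (exp (((c : ℂ) + r * exp (φ * I)) * t) *
        ((c : ℂ) + r * exp (φ * I)) ^ (-(z + 1 : ℝ) : ℂ) * exp (φ * I))) r := by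
    intro r hr
    have hs := add_mul_exp_mem_slitPlane hc hr hφπ
    have h1 : HasDerivAt (fun r : ℝ => (c : ℂ) + r * exp (φ * I)) (exp (φ * I)) r := by
      simpa using ((hasDerivAt_id r).ofReal_comp.mul_const (exp (φ * I))).const_add (c : ℂ)
    have h2 : HasDerivAt (fun s : ℂ => exp (s * t) * s ^ (-z : ℂ)) _
        ((c : ℂ) + r * exp (φ * I)) :=
      (((hasDerivAt_id _).mul_const (t : ℂ)).cexp).mul ((hasDerivAt_id _).cpow_const hs)
    refine (h2.comp r h1).congr_deriv ?_
    simp only [id]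
    rw [show (-((z + 1 : ℝ) : ℂ)) = -(z : ℂ) - 1 by push_cast; ring]
    ring
  have hlim : Tendsto (fun r : ℝ => exp (((c : ℂ) + r * exp (φ * I)) * t) *
      ((c : ℂ) + r * exp (φ * I)) ^ (-z : ℂ)) atTop (𝓝 0) := by
    have h0 : Tendsto (fun r => C * Real.exp (-ε * r)) atTop (𝓝 0) := by
      have : Tendsto (fun r => -ε * r) atTop atBot :=
        tendsto_id.const_mul_atTop_of_neg (neg_neg_of_pos hε)
      simpa using (Real.tendsto_exp_atBot.comp this).const_mul C
    refine squeeze_zero_norm' ?_ h0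
    filter_upwards [eventually_ge_atTop 0] with r hr
    exact (norm_exp_mul_cpow_le _ _ _ _).trans (hC r hr)
  have h := integral_Ioi_of_hasDerivAt_of_tendsto' hder
    ((hi1.const_mul _).sub (hi2.const_mul _)) hlim
  rw [integral_sub (hi1.const_mul _) (hi2.const_mul _), integral_const_mul,
    integral_const_mul] at h
  simpa [rayIntegral] using h

/-- Hankel's formula for the reciprocal Gamma function, on a V-shaped contour. -/
theorem rayIntegral_exp_mul_cpow_sub {c t θ : ℝ} (hc : 0 < c) (ht : 0 < t)
    (hθ : Real.pi / 2 < θ) (hθπ : θ < Real.pi) (z : ℝ) :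
    rayIntegral (fun s => exp (s * t) * s ^ (-z : ℂ)) c θ -
      rayIntegral (fun s => exp (s * t) * s ^ (-z : ℂ)) c (-θ) =
      2 * Real.pi * I * ((t : ℂ) ^ ((z : ℂ) - 1) / Gamma z) := by
  have hθ0 : 0 < θ := by linarith [Real.pi_pos]
  have hcos : Real.cos θ < 0 := Real.cos_neg_of_pi_div_two_lt_of_lt hθ (by linarith)
  have hcos' : Real.cos (-θ) < 0 := by rwa [Real.cos_neg]
  have habs : |θ| < Real.pi := by rwa [abs_of_pos hθ0]
  have habs' : |-θ| < Real.pi := by rwa [abs_neg]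
  have base : ∀ z : ℝ, 2 ≤ z → rayIntegral (fun s => exp (s * t) * s ^ (-z : ℂ)) c θ -
      rayIntegral (fun s => exp (s * t) * s ^ (-z : ℂ)) c (-θ) =
      2 * Real.pi * I * ((t : ℂ) ^ ((z : ℂ) - 1) / Gamma z) := by
    intro z hz
    obtain ⟨κ, hκ, hlow⟩ := exists_le_norm_add_mul_exp hc hθ0 hθπ
    have hb0 : ∀ r φ : ℝ, 0 ≤ r → |φ| ≤ θ → ‖((c : ℂ) + r * exp (φ * I)) ^ (-z : ℂ)‖ ≤
        (√κ ^ (2 - z) * κ⁻¹) * (1 + r ^ 2)⁻¹ := by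
      intro r φ hr hφ
      have hm : √κ ≤ ‖(c : ℂ) + r * exp (φ * I)‖ := by
        refine Real.sqrt_le_iff.2 ⟨norm_nonneg _, le_trans ?_ (hlow r φ hr hφ)⟩
        nlinarith [sq_nonneg r]
      refine (norm_cpow_neg_le hz (Real.sqrt_pos.2 hκ) hm).trans ?_
      rw [mul_assoc, ← mul_inv]
      gcongr
      exact hlow r φ hr hφ
    have hF : DifferentiableOn ℂ (fun s : ℂ => s ^ (-z : ℂ)) slitPlane := fun s hs =>
      (differentiableAt_id.cpow_const hs).differentiableWithinAt
    have hi : Integrable (fun y : ℝ => ((c : ℂ) + y * I) ^ (-z : ℂ)) := by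
      refine (integral_vertical_line_eq_of_bound (G := fun s => s ^ (-z : ℂ)) hθ.le
        (fun r φ hr _ hφ => hF.differentiableAt (isOpen_slitPlane.mem_nhds ?_))
        (fun r φ hr _ hφ => hb0 r φ hr hφ)).1
      exact add_mul_exp_mem_slitPlane hc hr (hφ.trans_lt hθπ)
    have h1 := (integral_vertical_line_exp_mul_eq ht hc hθ.le hθπ hF hb0).2
    have h2 := integral_vertical_line_exp_mul_cpow hz hc ht hi
    rw [← h1, integral_mul_const]
    have hG : Gamma (z : ℂ) ≠ 0 := Gamma_ne_zero_of_re_pos (by simpa using by linarith)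
    field_simp
    linear_combination h2
  -- Descent from `z + 1` to `z`. The boundary terms at the common vertex `c` cancel in the
  -- difference of the two rays, and what remains matches `1/Γ(z) = z/Γ(z+1)`, which also holds at
  -- the poles because `Γ` has value `0` there.
  have step : ∀ n : ℕ, ∀ z : ℝ, 2 ≤ z + n →
      rayIntegral (fun s => exp (s * t) * s ^ (-z : ℂ)) c θ -
      rayIntegral (fun s => exp (s * t) * s ^ (-z : ℂ)) c (-θ) =
      2 * Real.pi * I * ((t : ℂ) ^ ((z : ℂ) - 1) / Gamma z) := by
    intro n
    induction n with
    | zero => intro z hz; exact base z (by simpa using hz)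
    | succ n ih =>
      intro z hz
      have h1 := ih (z + 1) (by push_cast at hz; linarith)
      have h2 := rayIntegral_exp_mul_cpow_recursion hc ht habs hcos z
      have h3 := rayIntegral_exp_mul_cpow_recursion hc ht habs' hcos' z
      have ht0 : (t : ℂ) ≠ 0 := ofReal_ne_zero.2 ht.ne'
      have h4 := one_div_Gamma_eq_self_mul_one_div_Gamma_add_one (z : ℂ)
      have h5 : (t : ℂ) ^ (((z + 1 : ℝ) : ℂ) - 1) = t * (t : ℂ) ^ ((z : ℂ) - 1) := by
        rw [cpow_sub _ _ ht0, cpow_sub _ _ ht0, ofReal_add, ofReal_one, cpow_add _ _ ht0,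
          cpow_one]
        field_simp
      rw [h5, ofReal_add, ofReal_one] at h1
      rw [ofReal_add, ofReal_one] at h2 h3
      apply mul_left_cancel₀ ht0
      rw [inv_eq_one_div] at h4
      linear_combination h2 - h3 + z * h1 - 2 * Real.pi * I * t * (t : ℂ) ^ ((z : ℂ) - 1) * h4
  obtain ⟨n, hn⟩ := exists_nat_ge (2 - z)
  exact step n z (by linarith)

/-! ### The stretched exponential: Bromwich integral and Wright series -/

lemma abs_arg_add_mul_exp_le {c r φ θ : ℝ} (hc : 0 < c) (hr : 0 ≤ r) (hθ : Real.pi / 2 ≤ θ)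
    (hθπ : θ < Real.pi) (hφ : |φ| ≤ θ) : |arg ((c : ℂ) + r * exp (φ * I))| ≤ θ := by
  set s : ℂ := (c : ℂ) + r * exp (φ * I) with hs
  have hs0 : 0 < ‖s‖ :=
    norm_pos_iff.2 (slitPlane_ne_zero (add_mul_exp_mem_slitPlane hc hr (hφ.trans_lt hθπ)))
  -- Adding `c > 0` cannot turn a point away from the positive axis. Otherwise `c + r cos θ ≤ Re s <
  -- ‖s‖ cos θ ≤ (r - c) cos θ`, which forces `cos θ < -1`.
  by_contra! h
  have hθ0 : 0 ≤ θ := by linarith [Real.pi_pos]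
  have h1 : Real.cos (arg s) < Real.cos θ := by
    rw [← Real.cos_abs (arg s)]
    exact Real.cos_lt_cos_of_nonneg_of_le_pi hθ0 (abs_arg_le_pi s) h
  have h2 : Real.cos θ ≤ Real.cos φ := by
    rw [← Real.cos_abs φ]
    exact Real.cos_le_cos_of_nonneg_of_le_pi (abs_nonneg _) hθπ.le hφ
  have h3 : Real.cos θ ≤ 0 := Real.cos_nonpos_of_pi_div_two_le_of_le hθ (by linarith)
  have h4 : s.re = c + r * Real.cos φ := by
    rw [hs, add_re, ofReal_re, re_ofReal_mul, exp_ofReal_mul_I_re]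
  have h5 : r - c ≤ ‖s‖ := by
    have : ‖(r : ℂ) * exp (φ * I)‖ ≤ ‖s‖ + ‖(c : ℂ)‖ := by
      rw [show (r : ℂ) * exp (φ * I) = s - c by rw [hs]; ring]
      exact norm_sub_le _ _
    rw [norm_mul, norm_exp_ofReal_mul_I, mul_one, Complex.norm_of_nonneg hc.le,
      Complex.norm_of_nonneg hr] at this
    linarith
  have h6 := mul_lt_mul_of_pos_left h1 hs0
  rw [norm_mul_cos_arg, h4] at h6
  have h7 := mul_le_mul_of_nonpos_right h5 h3
  have h8 := mul_le_mul_of_nonneg_left h2 hr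
  nlinarith [Real.neg_one_le_cos θ]

lemma differentiableOn_stretchedExpTransform (ν μ : ℝ) :
    DifferentiableOn ℂ (stretchedExpTransform ν μ) slitPlane := fun _ hs =>
  ((differentiableAt_id.cpow_const hs).mul
    (differentiableAt_id.cpow_const hs).neg.cexp).differentiableWithinAt

/-- `|exp(-s^ν)| = exp(-|s|^ν cos(ν arg s))`, and the cosine decreases on `[0, π]`, so the worst
case is the edge `|arg s| = θ`. -/
lemma norm_stretchedExpTransform_le {ν θ δ : ℝ} (hν0 : 0 < ν) (hδ : Real.cos (θ * ν) = δ)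
    (hθν : θ * ν ≤ Real.pi) (μ : ℝ) {s : ℂ} (hs : |arg s| ≤ θ) :
    ‖stretchedExpTransform ν μ s‖ ≤ ‖s‖ ^ (-μ) * Real.exp (-(δ * ‖s‖ ^ ν)) := by
  rw [stretchedExpTransform, norm_mul, ← ofReal_neg, norm_cpow_real, norm_exp, neg_re,
    cpow_ofReal_re]
  have : δ ≤ Real.cos (arg s * ν) := by
    rw [← hδ, ← Real.cos_abs (arg s * ν), abs_mul, abs_of_pos hν0]
    exact Real.cos_le_cos_of_nonneg_of_le_pi (by positivity) hθν (by gcongr)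
  rw [mul_comm δ]
  gcongr

/-- The bound `π/2 < θ` gives decay of `e^{st}` on the final rays, and `θν < π/2` gives decay of
`e^{-s^ν}` in the sector swept; `ν < 1` makes both possible. -/
lemma exists_sector_angle {ν : ℝ} (hν0 : 0 < ν) (hν1 : ν < 1) :
    ∃ θ : ℝ, Real.pi / 2 < θ ∧ θ < Real.pi ∧ θ * ν < Real.pi / 2 := by
  have hpi := Real.pi_pos
  have h1 : 0 < 1 + ν := by linarith
  refine ⟨Real.pi / (1 + ν), ?_, ?_, ?_⟩
  · exact div_lt_div_of_pos_left hpi h1 (by linarith)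
  · exact div_lt_self hpi (by linarith)
  · rw [div_mul_eq_mul_div, div_lt_div_iff₀ h1 two_pos]
    nlinarith

/-- The Bromwich integral of the stretched exponential converges absolutely and equals the
integral over a V-shaped contour. -/
theorem exists_sector_bromwich {ν : ℝ} (hν0 : 0 < ν) (hν1 : ν < 1) {c t : ℝ} (hc : 0 < c)
    (ht : 0 < t) (μ : ℝ) : ∃ θ : ℝ, Real.pi / 2 < θ ∧ θ < Real.pi ∧
      VerticalIntegrable (bromwichIntegrand (stretchedExpTransform ν μ) t) c ∧
      fInv c ν μ t = 1 / (2 * Real.pi * I) *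
        (rayIntegral (bromwichIntegrand (stretchedExpTransform ν μ) t) c θ -
          rayIntegral (bromwichIntegrand (stretchedExpTransform ν μ) t) c (-θ)) := by
  obtain ⟨θ, hθ, hθπ, hθν⟩ := exists_sector_angle hν0 hν1
  have hpi := Real.pi_pos
  have hθ0 : 0 < θ := by linarith
  have hδ : 0 < Real.cos (θ * ν) :=
    Real.cos_pos_of_mem_Ioo ⟨by linarith [mul_pos hθ0 hν0], hθν⟩
  obtain ⟨κ, hκ, hlow⟩ := exists_le_norm_add_mul_exp hc hθ0 hθπ
  obtain ⟨C, hC0, hC⟩ := exists_rpow_mul_exp_neg_rpow_le hν0 hδ (Real.sqrt_pos.2 hκ) μ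
  have hb : ∀ r φ : ℝ, 0 ≤ r → |φ| ≤ θ →
      ‖stretchedExpTransform ν μ (c + r * exp (φ * I))‖ ≤ (C * κ⁻¹) * (1 + r ^ 2)⁻¹ := by
    intro r φ hr hφ
    have hm : √κ ≤ ‖(c : ℂ) + r * exp (φ * I)‖ := by
      refine Real.sqrt_le_iff.2 ⟨norm_nonneg _, le_trans ?_ (hlow r φ hr hφ)⟩
      nlinarith [sq_nonneg r]
    refine (norm_stretchedExpTransform_le hν0 rfl (by linarith) μ
      (abs_arg_add_mul_exp_le hc hr hθ.le hθπ hφ)).trans ((hC _ hm).trans ?_)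
    rw [mul_assoc, ← mul_inv]
    gcongr
    exact hlow r φ hr hφ
  have h := integral_vertical_line_exp_mul_eq ht hc hθ.le hθπ
    (differentiableOn_stretchedExpTransform ν μ) hb
  refine ⟨θ, hθ, hθπ, h.1, ?_⟩
  rw [fInv, inverseLaplace]
  congr 1
  exact h.2

lemma hasSum_stretchedExpTransform (ν μ : ℝ) {s : ℂ} (hs : s ≠ 0) :
    HasSum (fun k : ℕ => (-1) ^ k / (k.factorial : ℂ) * s ^ (-(μ - ν * k : ℝ) : ℂ))
      (stretchedExpTransform ν μ s) := by
  have h := (NormedSpace.expSeries_div_hasSum_exp (-s ^ (ν : ℂ))).mul_left (s ^ (-μ : ℂ))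
  rw [← exp_eq_exp_ℂ] at h
  refine h.congr_fun fun k => ?_
  have : s ^ (-(μ - ν * k : ℝ) : ℂ) = s ^ (-μ : ℂ) * (s ^ (ν : ℂ)) ^ k := by
    rw [← cpow_mul_nat, ← cpow_add _ _ hs]
    congr 1
    push_cast; ring
  rw [this, neg_pow]
  ring

/-- The sum of the absolute values of the terms, serving as the dominating function in both termwise
integrations. -/
lemma hasSum_norm_rpow (ν μ : ℝ) (x : ℝ) (hx : 0 < x) :
    HasSum (fun k : ℕ => 1 / (k.factorial : ℝ) * x ^ (-(μ - ν * k)))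
      (x ^ (-μ) * Real.exp (x ^ ν)) := by
  have h := (NormedSpace.expSeries_div_hasSum_exp (x ^ ν)).mul_left (x ^ (-μ))
  rw [← Real.exp_eq_exp_ℝ] at h
  refine h.congr_fun fun k => ?_
  rw [neg_sub, sub_eq_add_neg, add_comm, Real.rpow_add hx, Real.rpow_mul_natCast hx.le]
  ring

/-- Termwise integration of the exponential series along a ray in the left half plane. -/
lemma hasSum_rayIntegral_bromwichIntegrand {ν c t φ : ℝ} (hν0 : 0 < ν) (hν1 : ν < 1) (hc : 0 < c)
    (ht : 0 < t) (hφπ : |φ| < Real.pi) (hcos : Real.cos φ < 0) (μ : ℝ) :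
    HasSum (fun k : ℕ => (-1) ^ k / (k.factorial : ℂ) *
        rayIntegral (fun s => exp (s * t) * s ^ (-(μ - ν * k : ℝ) : ℂ)) c φ)
      (rayIntegral (bromwichIntegrand (stretchedExpTransform ν μ) t) c φ) := by
  have hsl : ∀ r ∈ Ioi (0 : ℝ), (c : ℂ) + r * exp (φ * I) ∈ slitPlane := fun r hr =>
    add_mul_exp_mem_slitPlane hc (le_of_lt hr) hφπ
  have hmaj : ∀ r ∈ Ioi (0 : ℝ), HasSum (fun k : ℕ => ‖exp (((c : ℂ) + r * exp (φ * I)) * t)‖ *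
      (1 / (k.factorial : ℝ) * ‖(c : ℂ) + r * exp (φ * I)‖ ^ (-(μ - ν * k)))) _ := fun r hr =>
    (hasSum_norm_rpow ν μ _ (norm_pos_iff.2 (slitPlane_ne_zero (hsl r hr)))).mul_left _
  have key := hasSum_integral_of_dominated_convergence (μ := volume.restrict (Ioi (0 : ℝ)))
    (F := fun (k : ℕ) (r : ℝ) => (-1) ^ k / (k.factorial : ℂ) *
      (exp (((c : ℂ) + r * exp (φ * I)) * t) *
        ((c : ℂ) + r * exp (φ * I)) ^ (-(μ - ν * k : ℝ) : ℂ) * exp (φ * I)))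
    (f := fun r : ℝ => bromwichIntegrand (stretchedExpTransform ν μ) t
      (c + r * exp (φ * I)) * exp (φ * I))
    (fun k r => ‖exp (((c : ℂ) + r * exp (φ * I)) * t)‖ *
      (1 / (k.factorial : ℝ) * ‖(c : ℂ) + r * exp (φ * I)‖ ^ (-(μ - ν * k))))
    (fun k => (((integrableOn_ray_exp_mul_cpow hc ht hφπ hcos _).mul_const _).const_mul
      _).aestronglyMeasurable) ?_ ?_ ?_ ?_
  · simpa only [integral_const_mul, rayIntegral] using key
  · refine fun k => Eventually.of_forall fun r => le_of_eq ?_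
    rw [norm_mul, norm_mul, norm_mul, norm_exp_ofReal_mul_I, mul_one, ← ofReal_neg,
      norm_cpow_real, norm_div, norm_pow, norm_neg, norm_one, one_pow, norm_natCast]
    ring
  · exact (ae_restrict_iff' measurableSet_Ioi).2 (Eventually.of_forall fun r hr =>
      (hmaj r hr).summable)
  · exact IntegrableOn.congr_fun (integrableOn_ray_majorant hν0 hν1 hc ht hφπ hcos μ)
      (fun r hr => (hmaj r hr).tsum_eq.symm) measurableSet_Ioi
  · refine (ae_restrict_iff' measurableSet_Ioi).2 (Eventually.of_forall fun r hr => ?_)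
    refine (((hasSum_stretchedExpTransform ν μ (slitPlane_ne_zero (hsl r hr))).mul_left
      (exp (((c : ℂ) + r * exp (φ * I)) * t))).mul_right (exp (φ * I))).congr_fun fun k => ?_
    ring

/-- Representation of the inverse Laplace transform by the Wright series. -/
theorem hasSum_fInv {ν : ℝ} (hν0 : 0 < ν) (hν1 : ν < 1) {c t : ℝ} (hc : 0 < c) (ht : 0 < t)
    (μ : ℝ) : HasSum (fun k : ℕ => ((t ^ (μ - 1) : ℝ) : ℂ) *
      wrightTerm (-ν) μ (-((t ^ (-ν) : ℝ) : ℂ)) k) (fInv c ν μ t) := by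
  obtain ⟨θ, hθ, hθπ, -, hf⟩ := exists_sector_bromwich hν0 hν1 hc ht μ
  have hθ0 : 0 < θ := by linarith [Real.pi_pos]
  have hcos : Real.cos θ < 0 := Real.cos_neg_of_pi_div_two_lt_of_lt hθ (by linarith)
  have habs : |θ| < Real.pi := by rwa [abs_of_pos hθ0]
  have h := ((hasSum_rayIntegral_bromwichIntegrand hν0 hν1 hc ht habs hcos μ).sub
    (hasSum_rayIntegral_bromwichIntegrand hν0 hν1 hc ht (φ := -θ) (by rwa [abs_neg])
      (by rwa [Real.cos_neg]) μ)).mul_left (1 / (2 * Real.pi * I))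
  rw [← hf] at h
  refine h.congr_fun fun k => ?_
  rw [← mul_sub, rayIntegral_exp_mul_cpow_sub hc ht hθ hθπ, wrightTerm, neg_pow]
  have h1 : (t : ℂ) ^ (((μ - ν * k : ℝ) : ℂ) - 1) =
      ((t ^ (μ - 1) : ℝ) : ℂ) * ((t ^ (-ν) : ℝ) : ℂ) ^ k := by
    rw [← ofReal_pow, ← Real.rpow_mul_natCast ht.le, ← ofReal_mul, ← Real.rpow_add ht,
      ofReal_cpow ht.le]
    congr 1
    push_cast; ring
  have h2 : ((-ν : ℝ) : ℂ) * k + μ = ((μ - ν * k : ℝ) : ℂ) := by push_cast; ring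
  rw [h1, h2]
  have hpi : (Real.pi : ℂ) ≠ 0 := ofReal_ne_zero.2 Real.pi_ne_zero
  field_simp

/-! ### The real integral representation -/

lemma sin_pi_mul_mul_Gamma_one_sub {s : ℝ} (hs : s < 1) :
    Real.sin (Real.pi * s) * Real.Gamma (1 - s) = Real.pi / Real.Gamma s := by
  have h := Real.Gamma_mul_Gamma_one_sub s
  have hG : 0 < Real.Gamma (1 - s) := Real.Gamma_pos_of_pos (by linarith)
  -- A zero of the sine with `s < 1` is a pole of `Γ`. There `Γ s` has value `0`, so the quotient on
  -- the right is `0` too.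
  by_cases h0 : Real.sin (Real.pi * s) = 0
  · rw [h0, div_zero, mul_eq_zero, or_iff_left hG.ne'] at h
    rw [h0, h, zero_mul, div_zero]
  · have hG' : Real.Gamma s ≠ 0 := by
      intro h1
      rw [h1, zero_mul, eq_comm, div_eq_zero_iff] at h
      exact h.elim Real.pi_ne_zero h0
    rw [eq_div_iff h0] at h
    rw [eq_div_iff hG']
    linear_combination h

lemma integrableOn_rpow_mul_exp_neg_mul_exp_rpow {ν μ t : ℝ} (hν0 : 0 < ν) (hν1 : ν < 1)
    (ht : 0 < t) (hμ : μ < 1) :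
    IntegrableOn (fun u : ℝ => Real.exp (-(u * t)) * (u ^ (-μ) * Real.exp (u ^ ν))) (Ioi 0) := by
  -- Half of `e^{-ut}` absorbs `e^{u^ν}`; `μ < 1` gives integrability of `u^{-μ}` at the origin.
  obtain ⟨K, hK⟩ := exists_rpow_le_add_mul hν0 hν1 (half_pos ht)
  have h1 := (integrableOn_rpow_mul_exp_neg_mul_rpow (p := 1) (s := -μ) (b := t / 2)
    (by linarith) one_pos (half_pos ht)).const_mul (Real.exp K)
  refine h1.mono' ?_ ?_
  · refine Measurable.aestronglyMeasurable (by fun_prop)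
  · refine (ae_restrict_iff' measurableSet_Ioi).2 (Eventually.of_forall fun u (hu : 0 < u) => ?_)
    rw [Real.norm_of_nonneg (by positivity), Real.rpow_one]
    calc _ ≤ Real.exp (-(u * t)) * (u ^ (-μ) * Real.exp (K + t / 2 * u)) := by
          gcongr; exact hK u hu.le
      _ = _ := by
          rw [mul_left_comm, mul_left_comm (Real.exp K), ← Real.exp_add, ← Real.exp_add]
          ring_nf

lemma abs_realIntegrand_le {ν μ t u : ℝ} (hu : 0 < u) :
    |realIntegrand ν μ t u| ≤ Real.exp (-(u * t)) * (u ^ (-μ) * Real.exp (u ^ ν)) := by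
  have h1 : -(u * t) - u ^ ν * Real.cos (Real.pi * ν) ≤ -(u * t) + u ^ ν := by
    have : 0 < u ^ ν := by positivity
    nlinarith [Real.neg_one_le_cos (Real.pi * ν)]
  rw [realIntegrand, abs_mul, abs_of_pos (by positivity)]
  calc _ ≤ u ^ (-μ) * Real.exp (-(u * t) + u ^ ν) * 1 := by
        gcongr; exact Real.abs_sin_le_one _
    _ = _ := by rw [Real.exp_add]; ring

lemma integrableOn_realIntegrand {ν μ t : ℝ} (hν0 : 0 < ν) (hν1 : ν < 1)
    (ht : 0 < t) (hμ : μ < 1) : IntegrableOn (realIntegrand ν μ t) (Ioi 0) := by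
  refine (integrableOn_rpow_mul_exp_neg_mul_exp_rpow hν0 hν1 ht hμ).mono' ?_ ?_
  · refine Measurable.aestronglyMeasurable ?_
    unfold realIntegrand
    fun_prop
  · exact (ae_restrict_iff' measurableSet_Ioi).2 (Eventually.of_forall fun u hu =>
      abs_realIntegrand_le hu)

/-- The integrand is the imaginary part of `u^{-μ} e^{-ut} e^{iπμ} exp(-u^ν e^{-iπν})`, the boundary
value of `e^{st} s^{-μ} e^{-s^ν}` at `s = u e^{-iπ}`. The `k`-th exponential term then has phase
`π(μ - νk)`. -/
lemma hasSum_realIntegrand {ν μ t u : ℝ} (hu : 0 < u) :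
    HasSum (fun k : ℕ => (-1) ^ k / (k.factorial : ℝ) * Real.sin (Real.pi * (μ - ν * k)) *
      (u ^ ((1 - (μ - ν * k)) - 1) * Real.exp (-(t * u)))) (realIntegrand ν μ t u) := by
  have h := ((NormedSpace.expSeries_div_hasSum_exp
    (-((u ^ ν : ℝ) * exp ((-(Real.pi * ν) : ℝ) * I)))).mul_left
    ((u ^ (-μ) * Real.exp (-(t * u)) : ℝ) * exp ((Real.pi * μ : ℝ) * I))).mapL imCLM
  rw [← exp_eq_exp_ℂ] at h
  convert h using 1
  · funext k
    have h1 : (-((u ^ ν : ℝ) * exp ((-(Real.pi * ν) : ℝ) * I))) ^ k =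
        (((-1) ^ k * (u ^ ν) ^ k : ℝ) : ℂ) * exp ((-(Real.pi * ν) * k : ℝ) * I) := by
      rw [neg_pow, mul_pow, ← Complex.exp_nat_mul]
      push_cast
      ring_nf
    have h2 : ((u ^ (-μ) * Real.exp (-(t * u)) : ℝ) : ℂ) * exp ((Real.pi * μ : ℝ) * I) *
        ((-((u ^ ν : ℝ) * exp ((-(Real.pi * ν) : ℝ) * I))) ^ k / (k.factorial : ℂ)) =
        ((u ^ (-μ) * Real.exp (-(t * u)) * ((-1) ^ k * (u ^ ν) ^ k) / k.factorial : ℝ) : ℂ) *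
          exp ((Real.pi * (μ - ν * k) : ℝ) * I) := by
      rw [h1, show ((Real.pi * (μ - ν * k) : ℝ) : ℂ) * I =
        (Real.pi * μ : ℝ) * I + (-(Real.pi * ν) * k : ℝ) * I by push_cast; ring, Complex.exp_add]
      push_cast
      ring
    rw [h2, imCLM_apply, im_ofReal_mul, exp_ofReal_mul_I_im,
      show (1 - (μ - ν * k)) - 1 = -μ + ν * k by ring, Real.rpow_add hu,
      Real.rpow_mul_natCast hu.le]
    ring
  · have h1 : -((u ^ ν : ℝ) * exp ((-(Real.pi * ν) : ℝ) * I)) =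
        ((-(u ^ ν * Real.cos (Real.pi * ν)) : ℝ) : ℂ) +
          ((u ^ ν * Real.sin (Real.pi * ν) : ℝ) : ℂ) * I := by
      rw [exp_mul_I, ← ofReal_cos, ← ofReal_sin, Real.cos_neg, Real.sin_neg]
      push_cast; ring
    have h2 : ((u ^ (-μ) * Real.exp (-(t * u)) : ℝ) : ℂ) * exp ((Real.pi * μ : ℝ) * I) *
        exp (-((u ^ ν : ℝ) * exp ((-(Real.pi * ν) : ℝ) * I))) =
        ((u ^ (-μ) * Real.exp (-(u * t) - u ^ ν * Real.cos (Real.pi * ν)) : ℝ) : ℂ) *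
          exp ((u ^ ν * Real.sin (Real.pi * ν) + Real.pi * μ : ℝ) * I) := by
      rw [h1, Complex.exp_add, ofReal_add, add_mul, Complex.exp_add, sub_eq_add_neg,
        Real.exp_add, mul_comm t u, ← ofReal_exp]
      push_cast
      ring
    rw [h2, imCLM_apply, im_ofReal_mul, exp_ofReal_mul_I_im, realIntegrand]

/-- With `s = μ - νk < 1`, Euler's integral of the `k`-th term gives `sin(πs) Γ(1-s) t^{s-1}`, and
reflection replaces the first two factors by `π/Γ(s)`. -/
theorem hasSum_integral_realIntegrand {ν μ t : ℝ} (hν0 : 0 < ν) (hν1 : ν < 1)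
    (ht : 0 < t) (hμ : μ < 1) :
    HasSum (fun k : ℕ => (((-1) ^ k / (k.factorial : ℝ) *
      (Real.pi / Real.Gamma (μ - ν * k)) * t ^ ((μ - ν * k) - 1))))
      (∫ u in Ioi (0 : ℝ), realIntegrand ν μ t u) := by
  have hs : ∀ k : ℕ, μ - ν * k < 1 := fun k => by
    have : 0 ≤ ν * k := by positivity
    linarith
  have hmaj : ∀ u ∈ Ioi (0 : ℝ), HasSum (fun k : ℕ => Real.exp (-(u * t)) *
      (1 / (k.factorial : ℝ) * u ^ (-(μ - ν * k)))) _ := fun u hu =>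
    (hasSum_norm_rpow ν μ u hu).mul_left _
  have key := hasSum_integral_of_dominated_convergence (μ := volume.restrict (Ioi (0 : ℝ)))
    (F := fun (k : ℕ) (u : ℝ) => (-1) ^ k / (k.factorial : ℝ) *
      Real.sin (Real.pi * (μ - ν * k)) * (u ^ ((1 - (μ - ν * k)) - 1) * Real.exp (-(t * u))))
    (f := realIntegrand ν μ t)
    (fun k u => Real.exp (-(u * t)) * (1 / (k.factorial : ℝ) * u ^ (-(μ - ν * k))))
    (fun k => Measurable.aestronglyMeasurable (by fun_prop)) ?_ ?_ ?_ ?_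
  · refine key.congr_fun fun k => ?_
    rw [integral_const_mul, Real.integral_rpow_mul_exp_neg_mul_Ioi (by linarith [hs k]) ht,
      ← sin_pi_mul_mul_Gamma_one_sub (hs k), one_div t, Real.inv_rpow ht.le,
      ← Real.rpow_neg ht.le, neg_sub]
    ring
  · refine fun k => (ae_restrict_iff' measurableSet_Ioi).2 (Eventually.of_forall
      fun u (hu : 0 < u) => ?_)
    rw [norm_mul, norm_mul, norm_div, norm_pow, norm_neg, norm_one, one_pow,
      Real.norm_of_nonneg (by positivity : 0 ≤ u ^ ((1 - (μ - ν * k)) - 1) * Real.exp (-(t * u))),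
      Real.norm_natCast, Real.norm_eq_abs, show (1 - (μ - ν * k)) - 1 = -(μ - ν * k) by ring]
    calc _ ≤ 1 / (k.factorial : ℝ) * 1 * (u ^ (-(μ - ν * k)) * Real.exp (-(t * u))) := by
          gcongr; exact Real.abs_sin_le_one _
      _ = _ := by rw [mul_comm t u]; ring
  · exact (ae_restrict_iff' measurableSet_Ioi).2 (Eventually.of_forall fun u hu =>
      (hmaj u hu).summable)
  · exact IntegrableOn.congr_fun (integrableOn_rpow_mul_exp_neg_mul_exp_rpow hν0 hν1 ht hμ)
      (fun u hu => (hmaj u hu).tsum_eq.symm) measurableSet_Ioi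
  · exact (ae_restrict_iff' measurableSet_Ioi).2 (Eventually.of_forall fun u hu =>
      hasSum_realIntegrand hu)

/-! ### Mainardi functions and conclusion -/

/-- Relation between the two Mainardi functions. -/
theorem mainardiF_eq {ν : ℝ} {z : ℂ} (hs : Summable (wrightTerm (-ν) ((1 - ν : ℝ) : ℂ) (-z))) :
    mainardiF ν z = ν * z * mainardiM ν z := by
  -- By `1/Γ(-ν(k+1)) = -ν(k+1)/Γ(1-ν-νk)`, the factor `k+1` cancels against the factorial and the
  -- sign against that of `-z`.
  have hshift : ∀ k : ℕ, wrightTerm (-ν) 0 (-z) (k + 1) =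
      ν * z * wrightTerm (-ν) (1 - ν) (-z) k := by
    intro k
    have h1 := one_div_Gamma_eq_self_mul_one_div_Gamma_add_one
      (((-ν : ℝ) : ℂ) * ((k + 1 : ℕ) : ℂ) + 0)
    have h2 : ((-ν : ℝ) : ℂ) * ((k + 1 : ℕ) : ℂ) + 0 + 1 = ((-ν : ℝ) : ℂ) * k + (1 - ν) := by
      push_cast; ring
    have hk : (k : ℂ) + 1 ≠ 0 := by exact_mod_cast k.succ_ne_zero
    have hk' : (k.factorial : ℂ) ≠ 0 := by exact_mod_cast k.factorial_ne_zero
    rw [wrightTerm, wrightTerm, div_eq_mul_inv, mul_inv, h1, h2, Nat.factorial_succ, pow_succ,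
      div_eq_mul_inv, mul_inv]
    push_cast
    field_simp
    ring
  -- The unshifted term carries `1/Γ(0)`, which is `0`.
  have h0 : wrightTerm (-ν) 0 (-z) 0 = 0 := by simp [wrightTerm]
  have hs' : HasSum (wrightTerm (-ν) (1 - ν) (-z)) (mainardiM ν z) := by
    push_cast at hs
    exact hs.hasSum
  have h := hs'.mul_left (ν * z)
  simp only [← hshift] at h
  rw [hasSum_nat_add_iff (f := wrightTerm (-ν) 0 (-z)) 1] at h
  simp only [Finset.range_one, Finset.sum_singleton, h0, add_zero] at h
  exact h.tsum_eq

theorem mainTheorem1 (ν : ℝ) (hν0 : 0 < ν) (hν1 : ν < 1) (c : ℝ) (hc : 0 < c)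
    (t : ℝ) (ht : 0 < t) :
    -- the Bromwich integral converges absolutely
    (∀ μ : ℝ, Complex.VerticalIntegrable
      (bromwichIntegrand (stretchedExpTransform ν μ) t) c) ∧
    -- real integral representation
    (∀ μ : ℝ, μ < 1 →
      IntegrableOn (realIntegrand ν μ t) (Set.Ioi 0) ∧
      fInv c ν μ t = ((1 / Real.pi * ∫ u in Set.Ioi (0 : ℝ), realIntegrand ν μ t u : ℝ) : ℂ)) ∧
    -- representation by the Wright function of the second kind
    (∀ μ : ℝ,
      Summable (wrightTerm (-ν) μ (-((t ^ (-ν) : ℝ) : ℂ))) ∧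
      fInv c ν μ t = ((t ^ (μ - 1) : ℝ) : ℂ) * wright (-ν) μ (-((t ^ (-ν) : ℝ) : ℂ))) ∧
    -- the case `μ = 1 - ν`: Mainardi functions
    fInv c ν (1 - ν) t = 1 / (ν : ℂ) * mainardiF ν ((t ^ (-ν) : ℝ) : ℂ) ∧
    fInv c ν (1 - ν) t = ((t ^ (-ν) : ℝ) : ℂ) * mainardiM ν ((t ^ (-ν) : ℝ) : ℂ) := by

  have hW : ∀ μ : ℝ, Summable (wrightTerm (-ν) μ (-((t ^ (-ν) : ℝ) : ℂ))) ∧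
      fInv c ν μ t = ((t ^ (μ - 1) : ℝ) : ℂ) * wright (-ν) μ (-((t ^ (-ν) : ℝ) : ℂ)) := by
    intro μ
    have h := hasSum_fInv hν0 hν1 hc ht μ
    have h0 : ((t ^ (μ - 1) : ℝ) : ℂ) ≠ 0 := ofReal_ne_zero.2 (Real.rpow_pos_of_pos ht _).ne'
    exact ⟨(summable_mul_left_iff h0).1 h.summable, by rw [← h.tsum_eq, tsum_mul_left, wright]⟩
  have hM : fInv c ν (1 - ν) t =
      ((t ^ (-ν) : ℝ) : ℂ) * mainardiM ν ((t ^ (-ν) : ℝ) : ℂ) := by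
    rw [(hW (1 - ν)).2, mainardiM, show 1 - ν - 1 = -ν by ring]
    push_cast
    rfl
  refine ⟨fun μ => ?_, fun μ hμ => ⟨integrableOn_realIntegrand hν0 hν1 ht hμ, ?_⟩, hW, ?_, hM⟩
  · obtain ⟨θ, -, -, h, -⟩ := exists_sector_bromwich hν0 hν1 hc ht μ
    exact h
  · have h := ((hasSum_integral_realIntegrand hν0 hν1 ht hμ).mul_left (1 / Real.pi)).mapL
      ofRealCLM
    -- Both sides are sums of the same series, compared term by term.
    refine (hasSum_fInv hν0 hν1 hc ht μ).unique (h.congr_fun fun k => ?_)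
    have h1 : t ^ (μ - ν * k - 1) = t ^ (μ - 1) * (t ^ (-ν)) ^ k := by
      rw [← Real.rpow_mul_natCast ht.le, ← Real.rpow_add ht]
      congr 1
      ring
    have hpi : (Real.pi : ℂ) ≠ 0 := ofReal_ne_zero.2 Real.pi_ne_zero
    have h2 : ((-ν : ℝ) : ℂ) * k + μ = ((μ - ν * k : ℝ) : ℂ) := by push_cast; ring
    rw [wrightTerm, h2, Gamma_ofReal, h1, ofRealCLM_apply, neg_pow]
    push_cast
    field_simp
  · rw [hM, mainardiF_eq (hW (1 - ν)).1]
    have : (ν : ℂ) ≠ 0 := ofReal_ne_zero.2 hν0.ne'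
    field_simp
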